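/- **Proposition (Vector Cauchy–Pompeiu Formula).** Let $X$ be a complex Banach space, $\Omega\subset\mathbb{C}$ an open set and $f\colon\Omega\to X$ a $C^\infty$ function (in the real sense). Write $\partial_{\bar z}f=\tfrac12(\partial_x f+i\,\partial_y f)$ and let $\ell$ be Lebesgue measure on $\mathbb{C}$. A function $g\colon S\to X$ on a measure space $(S,\mu)$ is *Pettis integrable* if $\Lambda\circ g\in L^1(\mu)$ for every $\Lambda\in X^*$ and, for every measurable $E\subset S$, there is a vector $P\!\int_E g\,d\mu\in X$ with $\Lambda\big(P\!\int_E g\,d\mu\big)=\int_E\Lambda\circ g\,d\mu$ for all $\Lambda\in X^*$. Let $\omega\subset\Omega$ be a bounded open set with smooth boundary $\partial\omega\subset\Omega$; that is, $\partial\omega$ is the union of finitely many pairwise disjoint simple closed curves with $C^\infty$ regular periodic parametrizations $\gamma_j\colon\mathbb{R}\to\mathbb{C}$ of period $1$, oriented so that near each boundary point $\omega$ lies on the left of $\gamma_j$ and not on the right. Denote this oriented boundary by $\gamma=\partial\omega$ and put $$P\!\int_{\partial\omega} g\,d\gamma=\sum_j P\!\int_0^1 g(\gamma_j(t))\,\gamma_j'(t)\,dt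 ,$$ where $g$ is called Pettis integrable along $\gamma$ if every summand has a Pettis integrable integrand. Let $\lambda\in\omega$. Then: 1. $\dfrac{f(z)}{z-\lambda}$ is Pettis integrable along $\gamma=\partial\omega$, $\dfrac{\partial_{\bar z}f(z)}{z-\lambda}$ is Pettis integrable over $\omega$ with respect to $\ell$, and $$f(\lambda)=\frac{1}{2\pi i}\,P\!\int_{\partial\omega}\frac{f(z)}{z-\lambda}\,d\gamma(z)-\frac1\pi\,P\!\int_{\omega}\frac{\partial_{\bar z}f(z)}{z-\lambda}\,d\ell(z).$$ 2. The right-hand side does not depend on the chosen curve: if $\omega_1,\omega_2\subset\Omega$ are two such sets with oriented boundaries $\gamma_1,\gamma_2\subset\Omega$ and $\lambda\in\omega_1\cap\omega_2$, then $$\frac{1}{2\pi i}P\!\int_{\gamma_1}\frac{f(z)}{z-\lambda}\,d\gamma_1(z)-\frac1\pi P\!\int_{\omega_1}\frac{\partial_{\bar z}f(z)}{z-\lambda}\,d\ell(z)=\frac{1}{2\pi i}P\!\int_{\gamma_2}\frac{f(z)}{z-\lambda}\,d\gamma_2(z)-\frac1\pi P\!\int_{\omega_2}\frac{\partial_{\bar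 z}f(z)}{z-\lambda}\,d\ell(z).$$ -/

import Mathlib

open MeasureTheory Set Filter Topology
open scoped ContDiff

namespace VectorCauchyPompeiu

noncomputable section

section Pettis

variable {α X : Type*} [MeasurableSpace α] [NormedAddCommGroup X] [NormedSpace ℂ X]

/-- `f` is scalarly integrable with respect to `μ`. -/
def ScalarlyIntegrable (f : α → X) (μ : Measure α) : Prop :=
  ∀ L : X →L[ℂ] ℂ, Integrable (fun a => L (f a)) μ

/-- `f` is scalarly integrable and the vector `x` of `X` (not merely of the bidual) satisfies
`L x = ∫ L ∘ f dμ` for every continuous linear functional `L`. -/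
def HasPettisIntegral (f : α → X) (μ : Measure α) (x : X) : Prop :=
  ScalarlyIntegrable f μ ∧ ∀ L : X →L[ℂ] ℂ, L x = ∫ a, L (f a) ∂μ

/-- Pettis integrability: the Pettis integral exists in `X` over every measurable set
(in particular over the whole space). -/
def PettisIntegrable (f : α → X) (μ : Measure α) : Prop :=
  ∀ s : Set α, MeasurableSet s → ∃ x : X, HasPettisIntegral f (μ.restrict s) x

open Classical in
/-- The Pettis integral `P∫ f dμ` (with the value `0` when it does not exist). -/
def pettisIntegral (f : α → X) (μ : Measure α) : X :=
  if h : ∃ x : X, HasPettisIntegral f μ x then h.choose else 0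

theorem PettisIntegrable.hasPettisIntegral {f : α → X} {μ : Measure α}
    (h : PettisIntegrable f μ) : HasPettisIntegral f μ (pettisIntegral f μ) := by
  have h' : ∃ x : X, HasPettisIntegral f μ x := by
    simpa using h univ MeasurableSet.univ
  rw [pettisIntegral, dif_pos h']
  exact h'.choose_spec

theorem HasPettisIntegral.unique {f : α → X} {μ : Measure α} {x y : X}
    (hx : HasPettisIntegral f μ x) (hy : HasPettisIntegral f μ y) : x = y := by
  refine (SeparatingDual.eq_iff_forall_dual_eq (R := ℂ)).2 fun L => ?_
  rw [hx.2 L, hy.2 L]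

end Pettis

/-- The Wirtinger derivative `∂f/∂z̄ = (∂f/∂x + i ∂f/∂y) / 2`. -/
def dbar {X : Type*} [NormedAddCommGroup X] [NormedSpace ℂ X] (f : ℂ → X) (z : ℂ) : X :=
  (1 / 2 : ℂ) • (fderiv ℝ f z 1 + Complex.I • fderiv ℝ f z Complex.I)

/-- A finite family of pairwise disjoint, regularly parametrized, smooth simple closed curves in
the plane; each is given as a function on `ℝ` of period `1`. -/
structure SmoothContour where
  n : ℕ
  curve : Fin n → ℝ → ℂ
  smooth : ∀ j, ContDiff ℝ ∞ (curve j)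
  periodic : ∀ j, Function.Periodic (curve j) 1
  regular : ∀ j t, deriv (curve j) t ≠ 0
  simple : ∀ j, InjOn (curve j) (Ico 0 1)
  disjoint : Pairwise fun j k => Disjoint (range (curve j)) (range (curve k))

/-- `D` is a bounded open set with smooth boundary and `γ` parametrizes `∂D` with its boundary
orientation: at every boundary point, `D` lies locally on the left of `γ` (the side of `i γ'`) and
only there. -/
structure SmoothContour.IsOrientedBoundary (γ : SmoothContour) (D : Set ℂ) : Prop where
  isOpen : IsOpen D
  isBounded : Bornology.IsBounded D
  frontier_eq : frontier D = ⋃ j, range (γ.curve j)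
  left_mem : ∀ j t, ∀ᶠ s : ℝ in 𝓝[>] 0,
    γ.curve j t + s * (Complex.I * deriv (γ.curve j) t) ∈ D
  right_notMem : ∀ j t, ∀ᶠ s : ℝ in 𝓝[>] 0,
    γ.curve j t - s * (Complex.I * deriv (γ.curve j) t) ∉ D

section Contour

variable {X : Type*} [NormedAddCommGroup X] [NormedSpace ℂ X]

/-- `g` is Pettis integrable against `dγ`, the complex measure `dz` carried by the contour: it is
the image under `γ` of `γ'(t) dt` on one period of each component. -/
def SmoothContour.PettisIntegrable (γ : SmoothContour) (g : ℂ → X) : Prop :=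
  ∀ j, VectorCauchyPompeiu.PettisIntegrable
    (fun t : ℝ => deriv (γ.curve j) t • g (γ.curve j t)) (volume.restrict (Ioc 0 1))

/-- The Pettis contour integral `P∫_γ g dγ`. -/
def SmoothContour.pettisIntegral (γ : SmoothContour) (g : ℂ → X) : X :=
  ∑ j, VectorCauchyPompeiu.pettisIntegral
    (fun t : ℝ => deriv (γ.curve j) t • g (γ.curve j t)) (volume.restrict (Ioc 0 1))

/-- The expression
`(1 / 2πi) P∫_γ f(z) / (z - w) dγ(z) - (1 / π) P∫_D ∂_z̄ f(z) / (z - w) dℓ(z)`. -/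
def cauchyPompeiu (f : ℂ → X) (D : Set ℂ) (γ : SmoothContour) (w : ℂ) : X :=
  (1 / (2 * Real.pi * Complex.I) : ℂ) • γ.pettisIntegral (fun z => (z - w)⁻¹ • f z)
    - (1 / Real.pi : ℂ) •
      pettisIntegral (fun z => (z - w)⁻¹ • dbar f z) (volume.restrict D)

end Contour

end

end VectorCauchyPompeiu

/-! No Green or Stokes theorem on the domain is used. A cutoff replaces `f` by a compactly supported
`C¹` function `F` on the plane that equals `f` near the closure of `D`. All integrands are then
Bochner integrable, so Pettis integrals are Bochner integrals.

For such `F`, `integral_cauchyKernel_dbar` gives `∫ (z - w)⁻¹ ∂̄F = -π F(w)` over the whole plane.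
In polar coordinates the kernel cancels the Jacobian; the radial derivative integrates to `-F(w)` on
each ray, and the angular one to zero on each circle.

Insert this representation of `F(γ(t))` into the contour integral and exchange the integrals. By
partial fractions the inner integral is `(W(w) - W(ζ)) / (ζ - w)`, where `W` is `2πi` times the
winding number. Off the contour, `W = 2πi` on `D` and `W = 0` outside, so what remains is `2πi`
times the integral over the complement of `D`; subtracting it from the plane integral gives the
formula.

The topological input is `winding_eq`. `W` is locally constant off the contour and rises by `2πi`
from right to left, exactly as `2πi · 1_D` does. Their difference is therefore locally constant
across the contour too, and it vanishes near infinity, so it is zero. Independence of the contour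
follows because both sides equal `f(w)`. -/

namespace VectorCauchyPompeiu

/-! ### Bochner integrable functions are Pettis integrable -/

section Pettis

variable {α X : Type*} [MeasurableSpace α] [NormedAddCommGroup X] [NormedSpace ℂ X]
  [CompleteSpace X]

theorem hasPettisIntegral_of_integrable {f : α → X} {μ : Measure α} (hf : Integrable f μ) :
    HasPettisIntegral f μ (∫ a, f a ∂μ) :=
  ⟨fun L => L.integrable_comp hf, fun L => (L.integral_comp_comm hf).symm⟩

theorem pettisIntegrable_of_integrable {f : α → X} {μ : Measure α} (hf : Integrable f μ) :
    PettisIntegrable f μ :=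
  fun _ _ => ⟨_, hasPettisIntegral_of_integrable (hf.mono_measure Measure.restrict_le_self)⟩

theorem pettisIntegral_eq_integral {f : α → X} {μ : Measure α} (hf : Integrable f μ) :
    pettisIntegral f μ = ∫ a, f a ∂μ :=
  (pettisIntegrable_of_integrable hf).hasPettisIntegral.unique (hasPettisIntegral_of_integrable hf)

end Pettis

/-! ### The Cauchy kernel and the Cauchy–Pompeiu formula in the whole plane -/

section CauchyKernel

/-- The Cauchy kernel is locally integrable in the plane. -/
theorem locallyIntegrable_inv : LocallyIntegrable (fun z : ℂ => z⁻¹) volume := by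
  refine locallyIntegrable_of_norm_le_rpow (C := 1) (α := 1) (by simp) (by simp) ?_ ?_
  · refine ae_of_all _ fun z => ?_
    rw [norm_inv, Real.rpow_neg_one, one_mul]
  · exact (measurable_inv).aestronglyMeasurable

variable {X : Type*} [NormedAddCommGroup X] [NormedSpace ℂ X]

theorem integrable_cauchyKernel_smul {g : ℂ → X} (hg : Continuous g) (hc : HasCompactSupport g)
    (w : ℂ) : Integrable (fun z => (z - w)⁻¹ • g z) := by
  have h1 : LocallyIntegrable (fun z : ℂ => (z - w)⁻¹) volume := by
    rw [locallyIntegrable_iff]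
    intro K hK
    have hK' : IsCompact ((fun z => z + w) ⁻¹' K) := by
      have := (Homeomorph.addRight w).isClosedEmbedding.isCompact_preimage hK
      exact this
    have := locallyIntegrable_inv.integrableOn_isCompact hK'
    have hm := (measurePreserving_add_right (volume : Measure ℂ) w)
    rw [← hm.integrableOn_comp_preimage (measurableEmbedding_addRight w)]
    refine this.congr_fun (fun z _ => ?_) (hK'.measurableSet)
    simp
  exact h1.integrable_smul_right_of_hasCompactSupport hg hc

theorem continuous_dbar {F : ℂ → X} (hF : ContDiff ℝ 1 F) : Continuous (dbar F) := by
  have := hF.continuous_fderiv (by norm_num)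
  unfold dbar
  fun_prop

theorem hasCompactSupport_dbar {F : ℂ → X} (hc : HasCompactSupport F) :
    HasCompactSupport (dbar F) := by
  refine (hc.fderiv ℝ).mono fun z hz => ?_
  contrapose! hz
  simp only [Function.mem_support, ne_eq, not_not] at hz ⊢
  simp [dbar, hz]

/-- The `∂̄`-derivative in polar coordinates. -/
theorem exp_neg_smul_dbar (F : ℂ → X) (z e : ℂ) (he : ‖e‖ = 1) :
    e⁻¹ • dbar F z = (1 / 2 : ℂ) • (fderiv ℝ F z e)
      + (Complex.I / 2) • (fderiv ℝ F z (Complex.I * e)) := by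
  have h1 : fderiv ℝ F z e = (e.re : ℂ) • fderiv ℝ F z 1 + (e.im : ℂ) • fderiv ℝ F z Complex.I := by
    conv_lhs => rw [show e = e.re • (1 : ℂ) + e.im • Complex.I by simp [Complex.re_add_im]]
    rw [map_add, map_smul, map_smul]; simp
  have h2 : fderiv ℝ F z (Complex.I * e)
      = (-e.im : ℂ) • fderiv ℝ F z 1 + (e.re : ℂ) • fderiv ℝ F z Complex.I := by
    conv_lhs => rw [show Complex.I * e = (-e.im) • (1 : ℂ) + e.re • Complex.I by
      apply Complex.ext <;> simp]
    rw [map_add, map_smul, map_smul]; simp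
  have h3 : e⁻¹ = e.re - e.im * Complex.I := by
    rw [Complex.inv_def, Complex.normSq_eq_norm_sq, he]
    apply Complex.ext <;> simp
  rw [h1, h2, h3, dbar]
  match_scalars
  · ring
  · linear_combination (-e.im / 2 : ℂ) * Complex.I_sq

/-- Fundamental theorem of calculus on the ray from `w`: compact support removes the endpoint at
infinity. -/
theorem integral_Ioi_fderiv_ray [CompleteSpace X] {F : ℂ → X} (hF : ContDiff ℝ 1 F)
    (hc : HasCompactSupport F) (w e : ℂ) (he : ‖e‖ = 1) :
    ∫ r in Ioi (0 : ℝ), fderiv ℝ F (w + r * e) e = - F w := by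
  have hd : ∀ r : ℝ, HasDerivAt (fun r : ℝ => F (w + r * e)) (fderiv ℝ F (w + r * e) e) r := by
    intro r
    have h1 : HasDerivAt (fun r : ℝ => w + r * e) e r := by
      simpa using ((Complex.ofRealCLM.hasDerivAt (x := r)).mul_const e).const_add w
    exact ((hF.differentiable (by norm_num)) _).hasFDerivAt.comp_hasDerivAt r h1
  have hcs : HasCompactSupport (fun r : ℝ => F (w + r * e)) := by
    refine hc.comp_isClosedEmbedding (g := fun r : ℝ => w + r * e) ?_
    refine Isometry.isClosedEmbedding (Isometry.of_dist_eq fun x y => ?_)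
    rw [dist_eq_norm, dist_eq_norm, add_sub_add_left_eq_sub, ← sub_mul, norm_mul, he, mul_one,
      ← Complex.ofReal_sub, Complex.norm_real]
  have hs : ContDiff ℝ 1 (fun r : ℝ => F (w + r * e)) :=
    hF.comp (contDiff_const.add (Complex.ofRealCLM.contDiff.mul contDiff_const))
  have := hcs.integral_Ioi_deriv_eq hs 0
  rw [integral_congr_ae (ae_of_all _ fun r => (hd r).deriv)] at this
  simpa using this

/-- The angular derivative of `F` is `r` times the integrand and integrates to zero because the
circle closes up; `r ≠ 0` allows dividing by it. -/
theorem integral_circle_fderiv [CompleteSpace X] {F : ℂ → X} (hF : ContDiff ℝ 1 F)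
    (w : ℂ) {r : ℝ} (hr : r ≠ 0) :
    ∫ θ in Ioo (-Real.pi) Real.pi,
      fderiv ℝ F (w + r * Complex.exp (θ * Complex.I)) (Complex.I * Complex.exp (θ * Complex.I))
        = 0 := by
  have hd : ∀ θ : ℝ, HasDerivAt (fun θ : ℝ => F (w + r * Complex.exp (θ * Complex.I)))
      (r • fderiv ℝ F (w + r * Complex.exp (θ * Complex.I))
        (Complex.I * Complex.exp (θ * Complex.I))) θ := by
    intro θ
    have h1 : HasDerivAt (fun θ : ℝ => w + r * Complex.exp (θ * Complex.I))
        (r • (Complex.I * Complex.exp (θ * Complex.I))) θ := by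
      have := ((((Complex.ofRealCLM.hasDerivAt (x := θ)).mul_const Complex.I).cexp).const_mul
        (r : ℂ)).const_add w
      refine HasDerivAt.congr_deriv this ?_
      simp [mul_comm]
    have := ((hF.differentiable (by norm_num)) _).hasFDerivAt.comp_hasDerivAt θ h1
    rwa [map_smul] at this
  have hcf := hF.continuous_fderiv (by norm_num)
  have h0 := intervalIntegral.integral_eq_sub_of_hasDerivAt (a := -Real.pi) (b := Real.pi)
    (fun θ _ => hd θ) (Continuous.intervalIntegrable (by fun_prop) _ _)
  rw [intervalIntegral.integral_smul, intervalIntegral.integral_of_le (by linarith [Real.pi_pos]),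
    integral_Ioc_eq_integral_Ioo] at h0
  have h1 : Complex.exp (((-Real.pi : ℝ) : ℂ) * Complex.I) = Complex.exp (Real.pi * Complex.I) := by
    rw [Complex.exp_pi_mul_I]; push_cast; rw [neg_mul, Complex.exp_neg, Complex.exp_pi_mul_I]
    norm_num
  rw [h1, sub_self] at h0
  exact (smul_eq_zero.1 h0).resolve_left hr

/-- The Cauchy–Pompeiu formula for compactly supported functions. -/
theorem integral_cauchyKernel_dbar [CompleteSpace X] {F : ℂ → X} (hF : ContDiff ℝ 1 F)
    (hc : HasCompactSupport F) (w : ℂ) :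
    ∫ z, (z - w)⁻¹ • dbar F z = -(Real.pi : ℂ) • F w := by
  have hcf := hF.continuous_fderiv (by norm_num)
  set E : ℝ → ℂ := fun θ => Complex.exp (θ * Complex.I) with hE
  have hEn : ∀ θ, ‖E θ‖ = 1 := fun θ => Complex.norm_exp_ofReal_mul_I θ
  have hEc : Continuous E := by fun_prop
  set A : ℝ × ℝ → X := fun p => fderiv ℝ F (w + p.1 * E p.2) (E p.2) with hA
  set B : ℝ × ℝ → X := fun p => fderiv ℝ F (w + p.1 * E p.2) (Complex.I * E p.2) with hB
  obtain ⟨R, hR0, hR⟩ : ∃ R > 0, ∀ z, R < ‖z‖ → fderiv ℝ F z = 0 := by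
    obtain ⟨R, hR0, hR⟩ := (hc.fderiv ℝ).isCompact.isBounded.exists_pos_norm_le
    refine ⟨R, hR0, fun z hz => ?_⟩
    by_contra h
    exact absurd (hR z (subset_tsupport _ h)) (not_le.2 hz)
  have hz : ∀ p ∈ (Ioi (0 : ℝ) ×ˢ Ioo (-Real.pi) Real.pi) \
      (Ioc 0 (R + ‖w‖) ×ˢ Ioo (-Real.pi) Real.pi), fderiv ℝ F (w + p.1 * E p.2) = 0 := by
    rintro ⟨r, θ⟩ ⟨⟨h1, h2⟩, h3⟩
    refine hR _ ?_
    have hr : R + ‖w‖ < r := by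
      by_contra h
      exact h3 ⟨⟨h1, not_lt.1 h⟩, h2⟩
    have := norm_sub_norm_le (r * E θ) (-w)
    rw [norm_mul, hEn, norm_neg, Complex.norm_real, Real.norm_of_nonneg (le_of_lt h1),
      sub_neg_eq_add, add_comm _ w] at this
    simp only
    linarith
  -- The polar strip is unbounded in `r`, but the integrands vanish once `r > R + ‖w‖`, so
  -- integrability reduces to a bounded rectangle.
  have hint : ∀ G : ℝ × ℝ → X, Continuous G → (∀ p, fderiv ℝ F (w + p.1 * E p.2) = 0 → G p = 0) →
      IntegrableOn G (Ioi (0 : ℝ) ×ˢ Ioo (-Real.pi) Real.pi) := by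
    intro G hG h0
    have : IntegrableOn G (Ioc 0 (R + ‖w‖) ×ˢ Ioo (-Real.pi) Real.pi) :=
      (hG.continuousOn.integrableOn_compact
        ((isCompact_Icc (a := 0) (b := R + ‖w‖)).prod
          (isCompact_Icc (a := -Real.pi) (b := Real.pi)))).mono_set
        (prod_mono Ioc_subset_Icc_self Ioo_subset_Icc_self)
    exact this.of_forall_sdiff_eq_zero (measurableSet_Ioi.prod measurableSet_Ioo)
      fun p hp => h0 p (hz p hp)
  have hAi : IntegrableOn A (Ioi (0 : ℝ) ×ˢ Ioo (-Real.pi) Real.pi) :=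
    hint A (by fun_prop) fun p hp => by simp [hA, hp]
  have hBi : IntegrableOn B (Ioi (0 : ℝ) ×ˢ Ioo (-Real.pi) Real.pi) :=
    hint B (by fun_prop) fun p hp => by simp [hB, hp]
  -- The order of integration differs for the two terms: `A` is integrated first along rays, `B`
  -- first along circles.
  have hAint : ∫ p in Ioi (0 : ℝ) ×ˢ Ioo (-Real.pi) Real.pi, A p = -((2 * Real.pi : ℂ) • F w) := by
    rw [Measure.volume_eq_prod] at hAi ⊢
    rw [← Measure.prod_restrict, integral_prod_symm _ (by rwa [Measure.prod_restrict])]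
    simp only [hA]
    rw [integral_congr_ae (ae_of_all _ fun θ => integral_Ioi_fderiv_ray hF hc w (E θ) (hEn θ))]
    rw [setIntegral_const, Real.volume_real_Ioo_of_le (by linarith [Real.pi_pos]), smul_neg,
      ← Complex.coe_smul]
    congr 2
    push_cast; ring
  have hBint : ∫ p in Ioi (0 : ℝ) ×ˢ Ioo (-Real.pi) Real.pi, B p = 0 := by
    rw [Measure.volume_eq_prod] at hBi ⊢
    rw [setIntegral_prod _ hBi]
    refine (setIntegral_congr_fun measurableSet_Ioi (g := fun _ => (0 : X)) fun r hr => ?_).trans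
      (by simp)
    exact integral_circle_fderiv hF w (ne_of_gt hr)
  calc ∫ z, (z - w)⁻¹ • dbar F z = ∫ z, z⁻¹ • dbar F (w + z) := by
        rw [← integral_add_left_eq_self (fun z => (z - w)⁻¹ • dbar F z) w]
        simp
    _ = ∫ p in Ioi (0 : ℝ) ×ˢ Ioo (-Real.pi) Real.pi,
          ((1 / 2 : ℂ) • A p + (Complex.I / 2) • B p) := by
        rw [← Complex.integral_comp_polarCoord_symm, polarCoord_target]
        refine setIntegral_congr_fun (measurableSet_Ioi.prod measurableSet_Ioo) fun p hp => ?_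
        have hp0 : (p.1 : ℂ) ≠ 0 := by exact_mod_cast (ne_of_gt hp.1)
        have hs : Complex.polarCoord.symm p = p.1 * E p.2 := by
          rw [Complex.polarCoord_symm_apply, hE]
          simp only
          rw [Complex.exp_mul_I, Complex.ofReal_cos, Complex.ofReal_sin]
        simp only [hs, hA, hB]
        -- The Jacobian `r` cancels the modulus in `(r e)⁻¹`, leaving `e⁻¹`.
        rw [← exp_neg_smul_dbar F _ _ (hEn p.2), ← Complex.coe_smul, smul_smul, mul_inv,
          mul_inv_cancel_left₀ hp0]
    _ = _ := by
        rw [integral_add (hAi.fun_smul _) (hBi.fun_smul _), integral_smul, integral_smul, hAint, hBint,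
          smul_zero, add_zero, smul_neg, smul_smul, neg_smul]
        congr 2
        ring

end CauchyKernel

noncomputable section

/-! ### Winding integrals and their jump across a curve -/

section Winding

/-- `2πi` times the winding number around `z` of the closed curve `c` of period `1`. -/
def windingIntegral (c : ℝ → ℂ) (z : ℂ) : ℂ :=
  ∫ t in (0 : ℝ)..1, deriv c t / (c t - z)

theorem integral_div_eq_log_sub_log {q q' : ℝ → ℂ} {a b : ℝ} (hab : a ≤ b)
    (hq : ∀ t ∈ Icc a b, HasDerivAt q (q' t) t) (hq' : ContinuousOn q' (Icc a b))
    (hs : ∀ t ∈ Icc a b, q t ∈ Complex.slitPlane) :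
    ∫ t in a..b, q' t / q t = Complex.log (q b) - Complex.log (q a) := by
  rw [← uIcc_of_le hab] at hq hq' hs
  refine intervalIntegral.integral_eq_sub_of_hasDerivAt (f := fun t => Complex.log (q t))
    (fun t ht => (hq t ht).clog_real (hs t ht)) ?_
  refine ContinuousOn.intervalIntegrable (hq'.div
    (fun t ht => (hq t ht).continuousAt.continuousWithinAt)
    fun t ht => Complex.slitPlane_ne_zero (hs t ht))

variable {c : ℝ → ℂ}

theorem intervalIntegrable_deriv_div (hc : ContDiff ℝ 1 c) {z : ℂ} {a b : ℝ}
    (hz : ∀ t ∈ uIcc a b, c t ≠ z) :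
    IntervalIntegrable (fun t => deriv c t / (c t - z)) volume a b :=
  ContinuousOn.intervalIntegrable ((hc.continuous_deriv le_rfl).continuousOn.div
    (hc.continuous.sub continuous_const).continuousOn fun t ht => sub_ne_zero.2 (hz t ht))

/-- The difference of the integrands is the logarithmic derivative of `(c - z) / (c - w)`. The
constant `σ` rotates this quotient away from the branch cut without changing that derivative. -/
theorem integral_deriv_div_sub (hc : ContDiff ℝ 1 c) {a b : ℝ} (hab : a ≤ b) {z w σ : ℂ}
    (hz : ∀ t ∈ Icc a b, c t ≠ z) (hw : ∀ t ∈ Icc a b, c t ≠ w)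
    (hs : ∀ t ∈ Icc a b, σ * ((c t - z) / (c t - w)) ∈ Complex.slitPlane) :
    (∫ t in a..b, deriv c t / (c t - z)) - ∫ t in a..b, deriv c t / (c t - w)
      = Complex.log (σ * ((c b - z) / (c b - w))) - Complex.log (σ * ((c a - z) / (c a - w))) := by
  have hd : ∀ t, HasDerivAt c (deriv c t) t := fun t =>
    (hc.differentiable one_ne_zero t).hasDerivAt
  have hcd := hc.continuous_deriv le_rfl
  rw [← intervalIntegral.integral_sub
    (intervalIntegrable_deriv_div hc (by rwa [uIcc_of_le hab]))
    (intervalIntegrable_deriv_div hc (by rwa [uIcc_of_le hab]))]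
  rw [← integral_div_eq_log_sub_log (q := fun t => σ * ((c t - z) / (c t - w)))
    (q' := fun t => σ * ((deriv c t * (c t - w) - (c t - z) * deriv c t) / (c t - w) ^ 2)) hab
    (fun t ht => (((hd t).sub_const z).div ((hd t).sub_const w)
      (sub_ne_zero.2 (hw t ht))).const_mul σ) ?_ hs]
  · refine intervalIntegral.integral_congr fun t ht => ?_
    rw [uIcc_of_le hab] at ht
    have h1 := sub_ne_zero.2 (hz t ht)
    have h2 := sub_ne_zero.2 (hw t ht)
    have h3 : σ ≠ 0 := left_ne_zero_of_mul (Complex.slitPlane_ne_zero (hs t ht))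
    field_simp
  · refine continuousOn_const.mul (ContinuousOn.div ?_ ?_ fun t ht =>
      pow_ne_zero 2 (sub_ne_zero.2 (hw t ht)))
    · exact ((hcd.mul (hc.continuous.sub continuous_const)).sub
        ((hc.continuous.sub continuous_const).mul hcd)).continuousOn
    · exact ((hc.continuous.sub continuous_const).pow 2).continuousOn

/-- The quotient `(c - z) / (c - w) = 1 + (w - z) / (c - w)` stays in the unit disc about `1`, so
its principal logarithm returns to its initial value along the closed curve. -/
theorem windingIntegral_eq (hc : ContDiff ℝ 1 c) (hp : Function.Periodic c 1) {z w : ℂ}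
    (h : ∀ t, ‖z - w‖ < ‖c t - w‖) : windingIntegral c z = windingIntegral c w := by
  have hw : ∀ t, c t ≠ w := fun t ht => by
    have := h t
    rw [ht, sub_self, norm_zero] at this
    exact absurd this (not_lt.2 (norm_nonneg _))
  have hz : ∀ t, c t ≠ z := fun t ht => by
    have := h t
    rw [ht] at this
    exact lt_irrefl _ this
  rw [← sub_eq_zero, windingIntegral, windingIntegral,
    integral_deriv_div_sub (σ := 1) hc zero_le_one (fun t _ => hz t) (fun t _ => hw t)]
  · have : c 1 = c 0 := by simpa using hp 0
    rw [this, sub_self]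
  · intro t _
    have h2 := sub_ne_zero.2 (hw t)
    have : 1 * ((c t - z) / (c t - w)) = 1 + (w - z) / (c t - w) := by
      field_simp; ring
    rw [this]
    refine Complex.mem_slitPlane_of_norm_lt_one ?_
    rw [norm_div, div_lt_one (norm_pos_iff.2 h2), norm_sub_rev]
    exact h t

/-- Here `1 - c / z` stays in the unit disc about `1`, so its principal logarithm is a periodic
primitive. -/
theorem windingIntegral_eq_zero (hc : ContDiff ℝ 1 c) (hp : Function.Periodic c 1) {z : ℂ}
    (h : ∀ t, ‖c t‖ < ‖z‖) : windingIntegral c z = 0 := by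
  have hz : z ≠ 0 := norm_pos_iff.1 ((norm_nonneg _).trans_lt (h 0))
  have hd : ∀ t, HasDerivAt c (deriv c t) t := fun t =>
    (hc.differentiable one_ne_zero t).hasDerivAt
  have key := integral_div_eq_log_sub_log (q := fun t => 1 + c t / (-z))
    (q' := fun t => deriv c t / (-z)) zero_le_one (fun t _ => ((hd t).div_const _).const_add 1)
    (((hc.continuous_deriv le_rfl).div_const _).continuousOn) fun t _ => by
      refine Complex.mem_slitPlane_of_norm_lt_one ?_
      rw [norm_div, norm_neg, div_lt_one (norm_pos_iff.2 hz)]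
      exact h t
  have h1 : c 1 = c 0 := by simpa using hp 0
  rw [h1, sub_self] at key
  rw [← key, windingIntegral]
  refine intervalIntegral.integral_congr fun t _ => ?_
  have h2 : c t - z ≠ 0 := sub_ne_zero.2 fun h3 => by
    have := h t
    rw [h3] at this
    exact lt_irrefl _ this
  have h3 : 1 + c t / (-z) = (c t - z) / (-z) := by field_simp; ring
  simp only [h3]
  rw [div_div_div_cancel_right₀ (neg_ne_zero.2 hz)]

theorem range_eq_image_Icc_of_periodic (hp : Function.Periodic c 1) (a : ℝ) :
    range c = c '' Icc a (a + 1) := (hp.image_Icc one_pos a).symm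

theorem isCompact_range_of_periodic (hc : Continuous c) (hp : Function.Periodic c 1) :
    IsCompact (range c) := by
  rw [range_eq_image_Icc_of_periodic hp 0]
  exact isCompact_Icc.image hc

theorem eventually_windingIntegral_eq (hc : ContDiff ℝ 1 c) (hp : Function.Periodic c 1) {w : ℂ}
    (hw : w ∉ range c) : ∀ᶠ z in 𝓝 w, windingIntegral c z = windingIntegral c w := by
  have hcl := (isCompact_range_of_periodic hc.continuous hp).isClosed
  obtain ⟨ε, hε, hb⟩ := Metric.isOpen_iff.1 hcl.isOpen_compl w hw
  filter_upwards [Metric.ball_mem_nhds w hε] with z hz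
  refine windingIntegral_eq hc hp fun t => ?_
  rw [mem_ball_iff_norm] at hz
  refine hz.trans_le ?_
  by_contra h
  exact hb (mem_ball_iff_norm.2 (not_le.1 h)) (mem_range_self t)

theorem periodic_deriv (hp : Function.Periodic c 1) : Function.Periodic (deriv c) 1 := fun t => by
  rw [← deriv_comp_add_const c 1 t, show (fun x => c (x + 1)) = c from funext hp]

theorem windingIntegral_eq_integral_add (hp : Function.Periodic c 1) (z : ℂ) (a : ℝ) :
    windingIntegral c z = ∫ t in a..a + 1, deriv c t / (c t - z) := by
  have hper : Function.Periodic (fun t => deriv c t / (c t - z)) 1 := fun t => by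
    simp only [hp t, periodic_deriv hp t]
  have := hper.intervalIntegral_add_eq 0 a
  rwa [zero_add] at this

/-- The winding number jumps by one across the curve. -/
theorem windingIntegral_jump (hc : ContDiff ℝ 1 c) (hp : Function.Periodic c 1) {t₀ δ : ℝ}
    (hδ : 0 < δ) (hδ' : δ < 1 / 2) {v : ℂ} (hv : v ≠ 0)
    (hpos : ∀ t ∈ Ioc t₀ (t₀ + δ), 0 < ((c t - c t₀) / v).re)
    (hneg : ∀ t ∈ Ico (t₀ - δ) t₀, ((c t - c t₀) / v).re < 0)
    (hfar : ∀ t ∈ Icc (t₀ + δ) (t₀ + 1 - δ), c t ≠ c t₀) :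
    ∀ᶠ s : ℝ in 𝓝[>] 0, windingIntegral c (c t₀ + s * (Complex.I * v))
      - windingIntegral c (c t₀ - s * (Complex.I * v)) = 2 * Real.pi * Complex.I := by
  obtain ⟨m, hm, hmb⟩ : ∃ m > 0, ∀ t ∈ Icc (t₀ + δ) (t₀ + 1 - δ), m ≤ ‖c t - c t₀‖ := by
    obtain ⟨x, hx, hxm⟩ := isCompact_Icc.exists_isMinOn
      (nonempty_Icc.2 (by linarith : t₀ + δ ≤ t₀ + 1 - δ))
      ((hc.continuous.sub continuous_const).norm.continuousOn (f := fun t => ‖c t - c t₀‖))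
    exact ⟨_, norm_pos_iff.2 (sub_ne_zero.2 (hfar x hx)), fun t ht => hxm ht⟩
  have hvn : 0 < ‖v‖ := norm_pos_iff.2 hv
  filter_upwards [Ioo_mem_nhdsGT (show (0 : ℝ) < m / (4 * ‖v‖) by positivity)] with s hs
  -- The bound on `s` puts `z` and `w` within `m / 4` of `c t₀`, while the far arc stays at distance
  -- at least `m`.
  obtain ⟨hs0, hsm⟩ := hs
  rw [lt_div_iff₀ (by positivity)] at hsm
  set z := c t₀ + s * (Complex.I * v) with hzdef
  set w := c t₀ - s * (Complex.I * v) with hwdef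
  set x : ℝ → ℂ := fun t => (c t - c t₀) / v with hx
  have hxc : ∀ t, c t - c t₀ = x t * v := fun t => by simp only [hx]; field_simp
  have hz : ∀ t, c t - z = (x t - s * Complex.I) * v := fun t => by
    rw [hzdef, sub_mul, ← hxc]; ring
  have hw : ∀ t, c t - w = (x t + s * Complex.I) * v := fun t => by
    rw [hwdef, add_mul, ← hxc]; ring
  have hq : ∀ t, (c t - z) / (c t - w) = (x t - s * Complex.I) / (x t + s * Complex.I) := fun t => by
    rw [hz, hw, mul_div_mul_right _ _ hv]
  have hx0 : x t₀ = 0 := by simp [hx]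
  -- the real part of `x` vanishes on the near arc only at the centre
  have hnear : ∀ t ∈ Icc (t₀ - δ) (t₀ + δ), t = t₀ ∨ (x t).re ≠ 0 := by
    intro t ht
    rcases lt_trichotomy t t₀ with h | h | h
    · exact Or.inr (hneg t ⟨ht.1, h⟩).ne
    · exact Or.inl h
    · exact Or.inr (hpos t ⟨h, ht.2⟩).ne'
  have hzne : ∀ t ∈ Icc (t₀ - δ) (t₀ + δ), x t - s * Complex.I ≠ 0 := by
    intro t ht h
    rcases hnear t ht with rfl | h1
    · have := congrArg Complex.im h
      simp [hx0] at this
      exact hs0.ne' this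
    · have := congrArg Complex.re h
      simp at this
      exact h1 this
  have hwne : ∀ t ∈ Icc (t₀ - δ) (t₀ + δ), x t + s * Complex.I ≠ 0 := by
    intro t ht h
    rcases hnear t ht with rfl | h1
    · have := congrArg Complex.im h
      simp [hx0] at this
      exact hs0.ne' this
    · have := congrArg Complex.re h
      simp at this
      exact h1 this
  -- For `s > 0` the imaginary part of the quotient has the sign opposite to that of the tangential
  -- coordinate.
  have him : ∀ y : ℂ, ((y - s * Complex.I) / (y + s * Complex.I)).im
      = -(2 * s * y.re) / Complex.normSq (y + s * Complex.I) := by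
    intro y
    rw [Complex.div_im]
    simp
    ring
  have hfarz : ∀ t ∈ Icc (t₀ + δ) (t₀ + 1 - δ), 2 * ‖s * (Complex.I * v)‖ < ‖c t - w‖ ∧ c t ≠ z := by
    intro t ht
    have h1 := hmb t ht
    have h2 : ‖s * (Complex.I * v)‖ = s * ‖v‖ := by
      simp [abs_of_pos hs0]
    have h3 : ‖c t - c t₀‖ ≤ ‖c t - w‖ + ‖s * (Complex.I * v)‖ := by
      calc ‖c t - c t₀‖ = ‖(c t - w) - s * (Complex.I * v)‖ := by rw [hwdef]; congr 1; ring
        _ ≤ _ := norm_sub_le _ _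
    refine ⟨by rw [h2] at h3 ⊢; linarith, fun h => ?_⟩
    rw [h, hzdef, add_sub_cancel_left, h2] at h1
    nlinarith
  -- On the near arc the quotient equals `-1` at `t₀` and is nonreal elsewhere, so `σ = -1` keeps it
  -- off the cut.
  have e1 := integral_deriv_div_sub (σ := -1) hc (by linarith : t₀ - δ ≤ t₀ + δ) (z := z) (w := w)
    (fun t ht => sub_ne_zero.1 (by rw [hz]; exact mul_ne_zero (hzne t ht) hv))
    (fun t ht => sub_ne_zero.1 (by rw [hw]; exact mul_ne_zero (hwne t ht) hv))
    (by
      intro t ht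
      rw [hq]
      rcases hnear t ht with rfl | h1
      · rw [hx0, zero_sub, zero_add, neg_div, div_self]
        · simp
        · simpa [hx0] using hwne t ht
      · rw [Complex.mem_slitPlane_iff]
        right
        rw [neg_one_mul, Complex.neg_im, him]
        have := (Complex.normSq_pos.2 (hwne t ht)).ne'
        simp [h1, hs0.ne']
        exact fun h => hwne t ht h)
  -- On the far arc the quotient is within distance `1` of `1`, so no rotation is needed.
  have e2 := integral_deriv_div_sub (σ := 1) hc (by linarith : t₀ + δ ≤ t₀ + 1 - δ) (z := z) (w := w)
    (fun t ht => (hfarz t ht).2)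
    (fun t ht h => by
      have := (hfarz t ht).1
      rw [h, sub_self, norm_zero] at this
      have := norm_nonneg (s * (Complex.I * v))
      linarith)
    (by
      intro t ht
      have h1 := (hfarz t ht).1
      have h2 : c t - w ≠ 0 := by
        rw [← norm_pos_iff]
        have := norm_nonneg (s * (Complex.I * v))
        linarith
      have : 1 * ((c t - z) / (c t - w)) = 1 + -(2 * (s * (Complex.I * v))) / (c t - w) := by
        field_simp
        rw [hzdef, hwdef]; ring
      rw [this]
      refine Complex.mem_slitPlane_of_norm_lt_one ?_
      rw [norm_div, div_lt_one (norm_pos_iff.2 h2), norm_neg, norm_mul]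
      simpa using h1)
  have hzr : ∀ t ∈ Icc (t₀ - δ) (t₀ - δ + 1), c t ≠ z ∧ c t ≠ w := by
    intro t ht
    rcases le_total t (t₀ + δ) with h | h
    · exact ⟨sub_ne_zero.1 (by rw [hz]; exact mul_ne_zero (hzne t ⟨ht.1, h⟩) hv),
        sub_ne_zero.1 (by rw [hw]; exact mul_ne_zero (hwne t ⟨ht.1, h⟩) hv)⟩
    · have ht' : t ∈ Icc (t₀ + δ) (t₀ + 1 - δ) := ⟨h, by linarith [ht.2]⟩
      refine ⟨(hfarz t ht').2, fun h => ?_⟩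
      have := (hfarz t ht').1
      rw [h, sub_self, norm_zero] at this
      have := norm_nonneg (s * (Complex.I * v))
      linarith
  have hend : c (t₀ + 1 - δ) = c (t₀ - δ) := by
    rw [← hp (t₀ - δ)]; congr 1; ring
  have hsplit : ∀ y, (∀ t ∈ Icc (t₀ - δ) (t₀ - δ + 1), c t ≠ y) → windingIntegral c y
      = (∫ t in t₀ - δ..t₀ + δ, deriv c t / (c t - y))
        + ∫ t in t₀ + δ..t₀ + 1 - δ, deriv c t / (c t - y) := by
    intro y hy
    rw [windingIntegral_eq_integral_add hp y (t₀ - δ), show t₀ + 1 - δ = t₀ - δ + 1 by ring,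
      intervalIntegral.integral_add_adjacent_intervals]
    · refine intervalIntegrable_deriv_div hc fun t ht => hy t ?_
      rw [uIcc_of_le (by linarith)] at ht
      exact ⟨ht.1, by linarith [ht.2]⟩
    · refine intervalIntegrable_deriv_div hc fun t ht => hy t ?_
      rw [uIcc_of_le (by linarith)] at ht
      exact ⟨by linarith [ht.1], ht.2⟩
  rw [hsplit z fun t ht => (hzr t ht).1, hsplit w fun t ht => (hzr t ht).2]
  rw [hend] at e2
  have him1 : ((c (t₀ + δ) - z) / (c (t₀ + δ) - w)).im < 0 := by
    rw [hq, him, div_neg_iff]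
    right
    refine ⟨?_, Complex.normSq_pos.2 (hwne _ ⟨by linarith, le_rfl⟩)⟩
    have := hpos (t₀ + δ) ⟨by linarith, le_rfl⟩
    have : 0 < 2 * s * (x (t₀ + δ)).re := by positivity
    linarith
  have him2 : 0 < ((c (t₀ - δ) - z) / (c (t₀ - δ) - w)).im := by
    rw [hq, him, div_pos_iff]
    left
    refine ⟨?_, Complex.normSq_pos.2 (hwne _ ⟨le_rfl, by linarith⟩)⟩
    have := hneg (t₀ - δ) ⟨le_rfl, by linarith⟩
    have : 0 < 2 * s * (-(x (t₀ - δ)).re) := mul_pos (by positivity) (neg_pos.2 this)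
    linarith
  -- The two branches of the logarithm differ by `πi` at one junction and by `-πi` at the other; as
  -- an end and a start of the near arc, they add up to `2πi`.
  have l1 : ∀ y : ℂ, y.im < 0 → Complex.log (-1 * y) = Complex.log y + Real.pi * Complex.I := by
    intro y hy
    rw [neg_one_mul, Complex.log, Complex.log, norm_neg, Complex.arg_neg_eq_arg_add_pi_of_im_neg hy]
    push_cast; ring
  have l2 : ∀ y : ℂ, 0 < y.im → Complex.log (-1 * y) = Complex.log y - Real.pi * Complex.I := by
    intro y hy
    rw [neg_one_mul, Complex.log, Complex.log, norm_neg, Complex.arg_neg_eq_arg_sub_pi_of_im_pos hy]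
    push_cast; ring
  rw [l1 _ him1, l2 _ him2] at e1
  rw [one_mul, one_mul] at e2
  linear_combination e1 + e2

/-- Equal values force equal fractional parts, hence an integer strictly between `0` and `1`. -/
theorem ne_of_injOn_Ico (hp : Function.Periodic c 1) (hi : InjOn c (Ico 0 1)) {t t₀ : ℝ}
    (h1 : t₀ < t) (h2 : t < t₀ + 1) : c t ≠ c t₀ := by
  intro h
  have hf : ∀ t, c (Int.fract t) = c t := fun t => by
    have := hp.sub_int_mul_eq (x := t) ⌊t⌋
    rwa [mul_one] at this
  have h3 := hi ⟨Int.fract_nonneg t, Int.fract_lt_one t⟩ ⟨Int.fract_nonneg t₀, Int.fract_lt_one t₀⟩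
    (by rw [hf, hf, h])
  obtain ⟨n, hn⟩ := Int.fract_eq_fract.1 h3
  have h4 : (0 : ℝ) < n := by linarith
  have h5 : (n : ℝ) < 1 := by linarith
  have h6 : 0 < n := by exact_mod_cast h4
  have h7 : n < 1 := by exact_mod_cast h5
  omega

/-- The tangential coordinate `((c t - c t₀) / c'(t₀)).re` has derivative `1` at `t₀`, so near `t₀`
it has the sign of `t - t₀`; injectivity handles the far arc. -/
theorem eventually_windingIntegral_jump (hc : ContDiff ℝ 1 c) (hp : Function.Periodic c 1)
    (hi : InjOn c (Ico 0 1)) {t₀ : ℝ} (hv : deriv c t₀ ≠ 0) :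
    ∀ᶠ s : ℝ in 𝓝[>] 0, windingIntegral c (c t₀ + s * (Complex.I * deriv c t₀))
      - windingIntegral c (c t₀ - s * (Complex.I * deriv c t₀)) = 2 * Real.pi * Complex.I := by
  set v := deriv c t₀ with hvdef
  have hd : HasDerivAt (fun t => ((c t - c t₀) / v).re) 1 t₀ := by
    have h1 : HasDerivAt (fun t => (c t - c t₀) / v) 1 t₀ := by
      have := ((hc.differentiable one_ne_zero t₀).hasDerivAt.sub_const (c t₀)).div_const v
      rwa [← hvdef, div_self hv] at this
    exact (Complex.reCLM.hasFDerivAt.comp_hasDerivAt t₀ h1).congr_deriv (by simp)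
  have hev := (hasDerivAt_iff_tendsto_slope.1 hd).eventually (lt_mem_nhds zero_lt_one)
  rw [eventually_nhdsWithin_iff, Metric.eventually_nhds_iff] at hev
  obtain ⟨ε, hε, hb⟩ := hev
  set δ := min (ε / 2) (1 / 4)
  have hδ : 0 < δ := by positivity
  have hδε : δ < ε := (min_le_left _ _).trans_lt (by linarith)
  have hδ1 : δ ≤ 1 / 4 := min_le_right _ _
  refine windingIntegral_jump hc hp hδ (by linarith) hv ?_ ?_ ?_
  · intro t ht
    have := hb (y := t) (by rw [Real.dist_eq, abs_lt]; constructor <;> linarith [ht.1, ht.2])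
      ht.1.ne'
    simp only [slope_def_field, sub_self, zero_div, Complex.zero_re, sub_zero] at this
    exact (div_pos_iff_of_pos_right (sub_pos.2 ht.1)).1 this
  · intro t ht
    have := hb (y := t) (by rw [Real.dist_eq, abs_lt]; constructor <;> linarith [ht.1, ht.2])
      ht.2.ne
    simp only [slope_def_field, sub_self, zero_div, Complex.zero_re, sub_zero] at this
    rcases div_pos_iff.1 this with h | h
    · linarith [ht.2, h.2]
    · exact h.1
  · intro t ht
    exact ne_of_injOn_Ico hp hi (by linarith [ht.1]) (by linarith [ht.2])

end Winding

/-! ### Local sides of the contour and its null area -/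

section Tube

/-- The normal coordinates `t + i s ↦ c t + s · i c'(t)` along a curve are strictly differentiable
at real points. -/
theorem hasStrictFDerivAt_normalCoord {c : ℝ → ℂ} (hc : ContDiff ℝ 2 c) (t₀ : ℝ)
    (hv : deriv c t₀ ≠ 0) :
    HasStrictFDerivAt (fun z : ℂ => c z.re + z.im * (Complex.I * deriv c z.re))
      ((ContinuousLinearEquiv.unitsEquivAut ℂ (Units.mk0 _ hv)).restrictScalars ℝ : ℂ →L[ℝ] ℂ)
      (t₀ : ℂ) := by
  have hcd : ContDiff ℝ 1 (deriv c) := by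
    have : ContDiff ℝ (1 + 1) c := hc.of_le (by norm_num [one_add_one_eq_two])
    exact (contDiff_succ_iff_deriv.1 this).2.2
  have h1 : ContDiff ℝ 1 (fun z : ℂ => c z.re + z.im * (Complex.I * deriv c z.re)) :=
    ((hc.of_le (by norm_num)).comp Complex.reCLM.contDiff).add
      ((Complex.ofRealCLM.contDiff.comp Complex.imCLM.contDiff).mul
        (contDiff_const.mul (hcd.comp Complex.reCLM.contDiff)))
  refine h1.contDiffAt.hasStrictFDerivAt' ?_ one_ne_zero
  have hre : HasFDerivAt (fun z : ℂ => z.re) Complex.reCLM (t₀ : ℂ) := Complex.reCLM.hasFDerivAt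
  have e1 : HasDerivAt c (deriv c t₀) (t₀ : ℂ).re :=
    (hc.differentiable (by norm_num) _).hasDerivAt
  have e2 : HasDerivAt (deriv c) (deriv (deriv c) t₀) (t₀ : ℂ).re :=
    (hcd.differentiable (by norm_num) _).hasDerivAt
  have d1 : HasFDerivAt (fun z : ℂ => c z.re) (Complex.reCLM.smulRight (deriv c t₀)) (t₀ : ℂ) :=
    e1.hasFDerivAt.comp (t₀ : ℂ) hre |>.congr_fderiv (by ext; simp)
  have d2 : HasFDerivAt (fun z : ℂ => Complex.I * deriv c z.re)
      (Complex.I • Complex.reCLM.smulRight (deriv (deriv c) t₀)) (t₀ : ℂ) :=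
    (e2.hasFDerivAt.comp (t₀ : ℂ) hre |>.congr_fderiv (by ext; simp)).const_mul Complex.I
  have d3 : HasFDerivAt (fun z : ℂ => (z.im : ℂ)) (Complex.ofRealCLM.comp Complex.imCLM) (t₀ : ℂ) :=
    (Complex.ofRealCLM.comp Complex.imCLM).hasFDerivAt
  refine (d1.add (d3.mul d2)).congr_fderiv ?_
  ext z
  simp
  conv_rhs => rw [← Complex.re_add_im z]
  ring

variable (γ : SmoothContour)

theorem SmoothContour.contDiff (j : Fin γ.n) (m : ℕ) : ContDiff ℝ m (γ.curve j) :=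
  (γ.smooth j).of_le (by exact_mod_cast le_top)

/-- The union of the curves of a contour. -/
def SmoothContour.trace : Set ℂ := ⋃ j, range (γ.curve j)

theorem SmoothContour.isCompact_range (j : Fin γ.n) : IsCompact (range (γ.curve j)) :=
  isCompact_range_of_periodic (γ.smooth j).continuous (γ.periodic j)

theorem SmoothContour.isCompact_trace : IsCompact γ.trace :=
  isCompact_iUnion γ.isCompact_range

/-- Near each of its points a smooth contour has two connected sides. -/
theorem SmoothContour.exists_sides (j : Fin γ.n) (t₀ : ℝ) :
    ∃ U ∈ 𝓝 (γ.curve j t₀), ∃ P M : Set ℂ, IsPreconnected P ∧ IsPreconnected M ∧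
      P ⊆ γ.traceᶜ ∧ M ⊆ γ.traceᶜ ∧ U \ γ.trace ⊆ P ∪ M ∧
      (∀ᶠ s : ℝ in 𝓝[>] 0, γ.curve j t₀ + s * (Complex.I * deriv (γ.curve j) t₀) ∈ P) ∧
      ∀ᶠ s : ℝ in 𝓝[>] 0, γ.curve j t₀ - s * (Complex.I * deriv (γ.curve j) t₀) ∈ M := by
  set c := γ.curve j with hcdef
  have hc : ContDiff ℝ 2 c := γ.contDiff j 2
  have hcd : Continuous (deriv c) := hc.continuous_deriv (by norm_num)
  have hΦ := hasStrictFDerivAt_normalCoord hc t₀ (γ.regular j t₀)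
  set Φ : ℂ → ℂ := fun z => c z.re + z.im * (Complex.I * deriv c z.re) with hΦdef
  have hΦc : Continuous Φ := by
    have := hc.continuous
    fun_prop
  have hΦr : ∀ t : ℝ, Φ t = c t := fun t => by simp [hΦdef]
  obtain ⟨ε₁, hε₁, hb₁⟩ := Metric.eventually_nhds_iff.1 hΦ.eventually_left_inverse
  set ρ := min (ε₁ / 2) (1 / 4)
  have hρ : 0 < ρ := by positivity
  have hρε : ρ < ε₁ := (min_le_left _ _).trans_lt (by linarith)
  have hρ1 : ρ ≤ 1 / 4 := min_le_right _ _
  -- `K` is the rest of the contour: the part of curve `j` outside the parameter window about `t₀`,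
  -- and all other curves.
  set K : Set ℂ := c '' Icc (t₀ + ρ) (t₀ + 1 - ρ) ∪ ⋃ k : {k // k ≠ j}, range (γ.curve k) with hK
  have hKc : IsClosed K := by
    refine ((isCompact_Icc.image hc.continuous).union ?_).isClosed
    exact isCompact_iUnion fun k => γ.isCompact_range k
  have hKp : Φ t₀ ∉ K := by
    rw [hΦr]
    rintro (⟨t, ht, h⟩ | h)
    · exact ne_of_injOn_Ico (γ.periodic j) (γ.simple j) (by linarith [ht.1]) (by linarith [ht.2]) h
    · obtain ⟨⟨k, hk⟩, hk'⟩ := mem_iUnion.1 h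
      exact disjoint_left.1 (γ.disjoint hk) hk' (mem_range_self t₀)
  obtain ⟨ε₂, hε₂, hb₂⟩ := Metric.eventually_nhds_iff.1
    (hΦc.continuousAt.eventually (hKc.isOpen_compl.mem_nhds hKp))
  set r := min ε₁ ε₂
  have hr : 0 < r := lt_min hε₁ hε₂
  have key : ∀ x ∈ Metric.ball (t₀ : ℂ) r, x.im ≠ 0 → Φ x ∉ γ.trace := by
    -- Near `t₀` only the window of curve `j` can be met. It is the image of real parameters, and
    -- the local left inverse of `Φ` then forces `x` to be real.
    intro x hx hx0 hmem
    have hxK := hb₂ (lt_of_lt_of_le hx (min_le_right _ _))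
    obtain ⟨k, hk⟩ := mem_iUnion.1 hmem
    by_cases hkj : k = j
    · subst hkj
      rw [range_eq_image_Icc_of_periodic (γ.periodic k) (t₀ - ρ)] at hk
      obtain ⟨t, ht, hte⟩ := hk
      rcases le_or_gt (t₀ + ρ) t with h | h
      · exact hxK (Or.inl ⟨t, ⟨h, by linarith [ht.2]⟩, hte⟩)
      · have h1 := hb₁ (y := (t : ℂ)) (by
          rw [Complex.dist_of_im_eq (by simp)]
          simp only [Complex.ofReal_re, Real.dist_eq, abs_lt]
          constructor <;> linarith [ht.1])
        have h2 := hb₁ (lt_of_lt_of_le hx (min_le_left _ _))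
        have h3 : Φ t = Φ x := by rw [hΦr]; exact hte
        rw [h3, h2] at h1
        exact hx0 (by rw [h1, Complex.ofReal_im])
    · exact hxK (Or.inr (mem_iUnion.2 ⟨⟨k, hkj⟩, hk⟩))
  have hline : ∀ s : ℝ, Φ (t₀ + s * Complex.I) = c t₀ + s * (Complex.I * deriv c t₀) := fun s => by
    simp [hΦdef]
  have hball : ∀ s : ℝ, |s| < r → (t₀ + s * Complex.I : ℂ) ∈ Metric.ball (t₀ : ℂ) r := fun s hs => by
    rw [mem_ball_iff_norm, add_sub_cancel_left]
    simpa using hs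
  refine ⟨Φ '' Metric.ball t₀ r, ?_, Φ '' (Metric.ball t₀ r ∩ {z | 0 < z.im}),
    Φ '' (Metric.ball t₀ r ∩ {z | z.im < 0}), ?_, ?_, ?_, ?_, ?_, ?_, ?_⟩
  · rw [← hΦr, ← hΦ.map_nhds_eq_of_equiv]
    exact image_mem_map (Metric.ball_mem_nhds _ hr)
  · exact (((convex_ball _ _).inter (convex_halfSpace_im_gt 0)).isPreconnected).image _
      hΦc.continuousOn
  · exact (((convex_ball _ _).inter (convex_halfSpace_im_lt 0)).isPreconnected).image _
      hΦc.continuousOn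
  · rintro _ ⟨x, ⟨hx, hx0⟩, rfl⟩
    exact key x hx (ne_of_gt hx0)
  · rintro _ ⟨x, ⟨hx, hx0⟩, rfl⟩
    exact key x hx (ne_of_lt hx0)
  · rintro _ ⟨⟨x, hx, rfl⟩, hn⟩
    rcases lt_trichotomy x.im 0 with h | h | h
    · exact Or.inr ⟨x, ⟨hx, h⟩, rfl⟩
    · exact absurd (mem_iUnion.2 ⟨j, x.re, by simp [hΦdef, h, hcdef]⟩ : Φ x ∈ γ.trace) hn
    · exact Or.inl ⟨x, ⟨hx, h⟩, rfl⟩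
  · filter_upwards [Ioo_mem_nhdsGT hr] with s hs
    exact ⟨t₀ + s * Complex.I, ⟨hball s (by rw [abs_of_pos hs.1]; exact hs.2),
      by simpa using hs.1⟩, hline s⟩
  · filter_upwards [Ioo_mem_nhdsGT hr] with s hs
    refine ⟨t₀ + (-s : ℝ) * Complex.I,
      ⟨hball (-s) (by rw [abs_neg, abs_of_pos hs.1]; exact hs.2), by simpa using hs.1⟩, ?_⟩
    rw [hline]; push_cast; ring

/-- Viewed as the image of the plane under `z ↦ c z.re`, the curve is null: the differential kills
`I`, so its determinant vanishes. -/
theorem volume_range_eq_zero {c : ℝ → ℂ} (hc : ContDiff ℝ 1 c) :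
    (volume : Measure ℂ) (range c) = 0 := by
  have h : range c = (fun z : ℂ => c z.re) '' univ := by
    rw [image_univ]
    ext w
    constructor
    · rintro ⟨t, rfl⟩
      exact ⟨t, by simp⟩
    · rintro ⟨z, rfl⟩
      exact ⟨z.re, rfl⟩
  rw [h]
  refine addHaar_image_eq_zero_of_det_fderivWithin_eq_zero volume
    (f' := fun z => Complex.reCLM.smulRight (deriv c z.re)) (fun z _ => ?_) fun z _ => ?_
  · have h1 : HasDerivAt c (deriv c z.re) (Complex.reCLM z) :=
      (hc.differentiable one_ne_zero _).hasDerivAt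
    exact ((h1.hasFDerivAt.comp z Complex.reCLM.hasFDerivAt).congr_fderiv
      (by ext; simp)).hasFDerivWithinAt
  · by_contra hne
    have hI := (LinearMap.equivOfDetNeZero
      ((Complex.reCLM.smulRight (deriv c z.re) : ℂ →L[ℝ] ℂ) : ℂ →ₗ[ℝ] ℂ) hne).injective
      (a₁ := Complex.I) (a₂ := 0) (by simp)
    exact Complex.I_ne_zero hI

theorem SmoothContour.volume_trace : volume γ.trace = 0 :=
  measure_iUnion_null fun j => volume_range_eq_zero (γ.contDiff j 1)

theorem SmoothContour.dense_compl_trace : Dense γ.traceᶜ := by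
  rw [← interior_eq_empty_iff_dense_compl]
  exact Measure.interior_eq_empty_of_null γ.volume_trace

end Tube

/-! ### The winding number of an oriented boundary -/

section Index

/-- `2πi` times the total winding number of a contour. -/
def SmoothContour.winding (γ : SmoothContour) (z : ℂ) : ℂ := ∑ j, windingIntegral (γ.curve j) z

variable {γ : SmoothContour} {D : Set ℂ}

theorem SmoothContour.eventually_winding_eq {w : ℂ} (hw : w ∉ γ.trace) :
    ∀ᶠ z in 𝓝 w, γ.winding z = γ.winding w := by
  have : ∀ j, ∀ᶠ z in 𝓝 w, windingIntegral (γ.curve j) z = windingIntegral (γ.curve j) w :=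
    fun j => eventually_windingIntegral_eq (γ.contDiff j 1) (γ.periodic j)
      fun h => hw (mem_iUnion.2 ⟨j, h⟩)
  filter_upwards [eventually_all.2 this] with z hz
  exact Finset.sum_congr rfl fun j _ => hz j

/-- Only curve `j` contributes: the others avoid the point, so their winding integrals are constant
near it. -/
theorem SmoothContour.eventually_winding_jump (j : Fin γ.n) (t₀ : ℝ) :
    ∀ᶠ s : ℝ in 𝓝[>] 0, γ.winding (γ.curve j t₀ + s * (Complex.I * deriv (γ.curve j) t₀))
      - γ.winding (γ.curve j t₀ - s * (Complex.I * deriv (γ.curve j) t₀))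
      = 2 * Real.pi * Complex.I := by
  set v := Complex.I * deriv (γ.curve j) t₀ with hv
  have hconst : ∀ k, k ≠ j → ∀ᶠ z in 𝓝 (γ.curve j t₀),
      windingIntegral (γ.curve k) z = windingIntegral (γ.curve k) (γ.curve j t₀) := fun k hk =>
    eventually_windingIntegral_eq (γ.contDiff k 1) (γ.periodic k)
      fun h => disjoint_left.1 (γ.disjoint hk) h (mem_range_self t₀)
  have hp : Tendsto (fun s : ℝ => γ.curve j t₀ + s * v) (𝓝[>] 0) (𝓝 (γ.curve j t₀)) := by
    have : Continuous (fun s : ℝ => γ.curve j t₀ + s * v) := by fun_prop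
    simpa using (this.tendsto 0).mono_left nhdsWithin_le_nhds
  have hm : Tendsto (fun s : ℝ => γ.curve j t₀ - s * v) (𝓝[>] 0) (𝓝 (γ.curve j t₀)) := by
    have : Continuous (fun s : ℝ => γ.curve j t₀ - s * v) := by fun_prop
    simpa using (this.tendsto 0).mono_left nhdsWithin_le_nhds
  have hall : ∀ᶠ s : ℝ in 𝓝[>] 0, ∀ k, k ≠ j →
      windingIntegral (γ.curve k) (γ.curve j t₀ + s * v)
        = windingIntegral (γ.curve k) (γ.curve j t₀ - s * v) := by
    refine eventually_all.2 fun k => ?_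
    by_cases hk : k = j
    · simp [hk]
    · filter_upwards [hp.eventually (hconst k hk), hm.eventually (hconst k hk)] with s h1 h2 _
      rw [h1, h2]
  filter_upwards [hall, eventually_windingIntegral_jump (γ.contDiff j 1) (γ.periodic j)
    (γ.simple j) (γ.regular j t₀)] with s h1 h2
  rw [winding, winding, ← Finset.sum_sub_distrib, Finset.sum_eq_single j]
  · exact h2
  · intro k _ hk
    rw [h1 k hk, sub_self]
  · simp

theorem SmoothContour.eventually_winding_eq_zero (γ : SmoothContour) :
    ∀ᶠ z in Bornology.cobounded ℂ, γ.winding z = 0 := by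
  obtain ⟨R, hR⟩ := γ.isCompact_trace.isBounded.exists_norm_le
  filter_upwards [tendsto_norm_cobounded_atTop.eventually (eventually_gt_atTop R)] with z hz
  refine Finset.sum_eq_zero fun j _ => ?_
  exact windingIntegral_eq_zero (γ.contDiff j 1) (γ.periodic j) fun t =>
    (hR _ (mem_iUnion.2 ⟨j, mem_range_self t⟩)).trans_lt hz

theorem eq_of_isPreconnected_of_eventually_eq {Y : Type*} {u : ℂ → Y} {S : Set ℂ}
    (hS : IsPreconnected S) (hu : ∀ x ∈ S, ∀ᶠ y in 𝓝 x, u y = u x) {x y : ℂ} (hx : x ∈ S)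
    (hy : y ∈ S) : u x = u y := by
  refine hS.induction₂ (fun x y => u x = u y) (fun x hx => ?_) ?_ ?_ hx hy
  · filter_upwards [(hu x hx).filter_mono nhdsWithin_le_nhds] with y hy using hy.symm
  · exact fun _ _ _ _ _ _ h1 h2 => h1.trans h2
  · exact fun _ _ _ _ h => h.symm

open Classical in
/-- The oriented boundary of `D` winds once around the points of `D` and does not wind around the
exterior points. -/
theorem SmoothContour.IsOrientedBoundary.winding_eq (h : γ.IsOrientedBoundary D) {z : ℂ}
    (hz : z ∉ γ.trace) : γ.winding z = if z ∈ D then 2 * Real.pi * Complex.I else 0 := by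
  have hfr : frontier D = γ.trace := h.frontier_eq
  set u : ℂ → ℂ := fun z => γ.winding z - if z ∈ D then 2 * Real.pi * Complex.I else 0 with hu
  have hloc : ∀ x ∉ γ.trace, ∀ᶠ y in 𝓝 x, u y = u x := by
    intro x hx
    have hmem : ∀ᶠ y in 𝓝 x, (y ∈ D ↔ x ∈ D) := by
      by_cases hxD : x ∈ D
      · filter_upwards [h.isOpen.mem_nhds hxD] with y hy
        simp [hy, hxD]
      · have : x ∉ closure D := fun hc => hx (hfr ▸ ⟨hc, by rwa [h.isOpen.interior_eq]⟩)
        filter_upwards [isClosed_closure.isOpen_compl.mem_nhds this] with y hy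
        have : y ∉ D := fun h => hy (subset_closure h)
        simp [this, hxD]
    filter_upwards [γ.eventually_winding_eq hx, hmem] with y h1 h2
    simp only [hu, h1, h2]
  -- At a contour point `u` is constant on each side. One small `s` probes both sides, where the
  -- jumps of the winding and of the indicator cancel.
  have hconst : ∀ x, ∃ a, ∀ᶠ y in 𝓝[γ.traceᶜ] x, u y = a := by
    intro x
    by_cases hx : x ∈ γ.trace
    · obtain ⟨j, t₀, rfl⟩ := mem_iUnion.1 hx
      obtain ⟨U, hU, P, M, hP, hM, hPt, hMt, hUs, hPs, hMs⟩ := γ.exists_sides j t₀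
      obtain ⟨s, h1, h2, h3, h4, h5⟩ := (hPs.and (hMs.and ((h.left_mem j t₀).and
        ((h.right_notMem j t₀).and (γ.eventually_winding_jump j t₀))))).exists
      refine ⟨u (γ.curve j t₀ + s * (Complex.I * deriv (γ.curve j) t₀)), ?_⟩
      have heq : u (γ.curve j t₀ + s * (Complex.I * deriv (γ.curve j) t₀))
          = u (γ.curve j t₀ - s * (Complex.I * deriv (γ.curve j) t₀)) := by
        simp only [hu, if_pos h3, if_neg h4]
        linear_combination h5
      filter_upwards [mem_nhdsWithin_of_mem_nhds hU, self_mem_nhdsWithin] with y hy hyt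
      rcases hUs ⟨hy, hyt⟩ with hy | hy
      · exact eq_of_isPreconnected_of_eventually_eq hP (fun x hx => hloc x (hPt hx)) hy h1
      · rw [heq]
        exact eq_of_isPreconnected_of_eventually_eq hM (fun x hx => hloc x (hMt hx)) hy h2
    · exact ⟨u x, (hloc x hx).filter_mono nhdsWithin_le_nhds⟩
  have hne : ∀ x, (𝓝[γ.traceᶜ] x).NeBot := fun x =>
    mem_closure_iff_nhdsWithin_neBot.1 (γ.dense_compl_trace x)
  -- `u` has no meaningful value on the contour, so the connectedness argument uses its limit
  -- through the dense complement.
  set S : Set ℂ := {x | ∀ᶠ y in 𝓝[γ.traceᶜ] x, u y = 0} with hS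
  have hopen : IsOpen S := by
    rw [isOpen_iff_mem_nhds]
    intro x hx
    have := eventually_nhds_nhdsWithin.2 hx
    exact this
  have hclosed : IsClosed S := by
    rw [← isOpen_compl_iff, isOpen_iff_mem_nhds]
    intro x hx
    obtain ⟨a, ha⟩ := hconst x
    have ha0 : a ≠ 0 := by
      rintro rfl
      exact hx ha
    filter_upwards [eventually_nhds_nhdsWithin.2 ha] with y hy hyS
    obtain ⟨y', h1, h2⟩ := (hy.and hyS).exists
    exact ha0 (h1.symm.trans h2)
  have hnonempty : S.Nonempty := by
    have h1 : ∀ᶠ x in Bornology.cobounded ℂ, x ∉ γ.trace :=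
      γ.isCompact_trace.isBounded
    have h2 : ∀ᶠ x in Bornology.cobounded ℂ, x ∉ D := h.isBounded
    obtain ⟨x, h3, h4, h5⟩ := (h1.and (h2.and γ.eventually_winding_eq_zero)).exists
    refine ⟨x, ?_⟩
    have : u x = 0 := by simp [hu, h4, h5]
    have h6 := (hloc x h3).filter_mono (nhdsWithin_le_nhds (s := γ.traceᶜ))
    rwa [this] at h6
  have huniv : S = univ := IsClopen.eq_univ ⟨hclosed, hopen⟩ hnonempty
  have hzS : z ∈ S := huniv ▸ mem_univ z
  have := (show ∀ᶠ y in 𝓝[γ.traceᶜ] z, u y = 0 from hzS).self_of_nhdsWithin hz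
  exact sub_eq_zero.1 this

end Index

/-! ### Exchanging the contour and area integrals -/

section Fubini

variable {X : Type*} [NormedAddCommGroup X] [NormedSpace ℂ X]

/-- This is the convolution of the locally integrable `‖z⁻¹‖` with the continuous, compactly
supported `‖g‖`. Its continuity supplies the outer integrability in Fubini. -/
theorem continuous_integral_norm_cauchyKernel_smul {g : ℂ → X} (hg : Continuous g)
    (hc : HasCompactSupport g) : Continuous fun z => ∫ ζ, ‖(ζ - z)⁻¹ • g ζ‖ := by
  have h1 : LocallyIntegrable (fun z : ℂ => ‖z⁻¹‖) volume := by
    intro x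
    obtain ⟨U, hU, hi⟩ := locallyIntegrable_inv x
    exact ⟨U, hU, hi.norm⟩
  have h2 := hc.norm.continuous_convolution_right (ContinuousLinearMap.mul ℝ ℝ) h1 hg.norm
  convert h2 using 2 with z
  rw [convolution, ← integral_sub_left_eq_self _ _ z]
  refine integral_congr_ae (ae_of_all _ fun ζ => ?_)
  simp [norm_smul]

theorem integrable_prod_cauchyKernel {c a : ℝ → ℂ} (hcc : Continuous c) (ha : Continuous a)
    {g : ℂ → X} (hg : Continuous g) (hc : HasCompactSupport g) :
    Integrable (fun p : ℝ × ℂ => a p.1 • (p.2 - c p.1)⁻¹ • g p.2)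
      ((volume.restrict (Ioc (0 : ℝ) 1)).prod volume) := by
  have hmeas : AEStronglyMeasurable (fun p : ℝ × ℂ => a p.1 • (p.2 - c p.1)⁻¹ • g p.2)
      ((volume.restrict (Ioc (0 : ℝ) 1)).prod volume) := by
    refine AEStronglyMeasurable.smul (by fun_prop) (AEStronglyMeasurable.smul ?_ ?_)
    · have : Continuous fun p : ℝ × ℂ => p.2 - c p.1 := by fun_prop
      exact this.measurable.inv.aestronglyMeasurable
    · exact (hg.comp continuous_snd).aestronglyMeasurable
  rw [integrable_prod_iff hmeas]
  refine ⟨ae_of_all _ fun t => (integrable_cauchyKernel_smul hg hc (c t)).smul (a t), ?_⟩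
  have : Continuous fun t => ‖a t‖ * ∫ ζ, ‖(ζ - c t)⁻¹ • g ζ‖ :=
    ha.norm.mul ((continuous_integral_norm_cauchyKernel_smul hg hc).comp hcc)
  refine ((this.integrableOn_Ioc (a := 0) (b := 1)).congr_fun (fun t _ => ?_) measurableSet_Ioc)
  simp only [norm_smul (a t), integral_const_mul]

/-- Partial fractions: `(ζ - w) / ((c - w)(ζ - c)) = 1 / (c - w) - 1 / (c - ζ)`. -/
theorem integral_deriv_mul_cauchyKernels {c : ℝ → ℂ} (hc : ContDiff ℝ 1 c) {w ζ : ℂ}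
    (hw : w ∉ range c) (hζ : ζ ∉ range c) (hne : ζ ≠ w) :
    ∫ t in Ioc (0 : ℝ) 1, (deriv c t * (c t - w)⁻¹) * (ζ - c t)⁻¹
      = (windingIntegral c w - windingIntegral c ζ) * (ζ - w)⁻¹ := by
  have hw' : ∀ t, c t ≠ w := fun t h => hw ⟨t, h⟩
  have hζ' : ∀ t, c t ≠ ζ := fun t h => hζ ⟨t, h⟩
  rw [windingIntegral, windingIntegral, ← intervalIntegral.integral_sub
    (intervalIntegrable_deriv_div hc fun t _ => hw' t)
    (intervalIntegrable_deriv_div hc fun t _ => hζ' t), ← intervalIntegral.integral_mul_const,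
    intervalIntegral.integral_of_le zero_le_one]
  refine integral_congr_ae (ae_of_all _ fun t => ?_)
  have h1 := sub_ne_zero.2 (hw' t)
  have h2 := sub_ne_zero.2 (hζ' t)
  have h3 := sub_ne_zero.2 hne
  have h4 : ζ - c t ≠ 0 := sub_ne_zero.2 (hζ' t).symm
  have h5 : c t - ζ = -(ζ - c t) := by ring
  simp only [h5]
  field_simp
  ring

/-- The Cauchy integral of a compactly supported function along one closed curve. -/
theorem integral_curve_cauchyKernel [CompleteSpace X] {c : ℝ → ℂ} (hc : ContDiff ℝ 1 c)
    {F : ℂ → X} (hF : ContDiff ℝ 1 F) (hs : HasCompactSupport F) {w : ℂ} (hw : w ∉ range c) :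
    Integrable (fun ζ => ((windingIntegral c w - windingIntegral c ζ) * (ζ - w)⁻¹) • dbar F ζ) ∧
    (Real.pi : ℂ) • ∫ t in Ioc (0 : ℝ) 1, deriv c t • (c t - w)⁻¹ • F (c t)
      = -∫ ζ, ((windingIntegral c w - windingIntegral c ζ) * (ζ - w)⁻¹) • dbar F ζ := by
  have hw' : ∀ t, c t - w ≠ 0 := fun t h => hw ⟨t, sub_eq_zero.1 h⟩
  have hcc := hc.continuous
  have hcd := hc.continuous_deriv le_rfl
  set a : ℝ → ℂ := fun t => deriv c t * (c t - w)⁻¹ with ha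
  have hac : Continuous a := hcd.mul ((hcc.sub continuous_const).inv₀ hw')
  have hI := integrable_prod_cauchyKernel hcc hac (continuous_dbar hF) (hasCompactSupport_dbar hs)
  have hinner : ∀ᵐ ζ : ℂ, ∫ t in Ioc (0 : ℝ) 1, a t • (ζ - c t)⁻¹ • dbar F ζ
      = ((windingIntegral c w - windingIntegral c ζ) * (ζ - w)⁻¹) • dbar F ζ := by
    have h1 : ∀ᵐ ζ : ℂ, ζ ∉ range c := measure_eq_zero_iff_ae_notMem.1 (volume_range_eq_zero hc)
    have h2 : ∀ᵐ ζ : ℂ, ζ ≠ w := by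
      have := measure_eq_zero_iff_ae_notMem.1 (measure_singleton (μ := (volume : Measure ℂ)) w)
      simpa using this
    filter_upwards [h1, h2] with ζ h1 h2
    rw [← integral_deriv_mul_cauchyKernels hc hw h1 h2, ← integral_smul_const]
    simp only [ha, smul_smul]
  refine ⟨hI.integral_prod_right.congr hinner, ?_⟩
  rw [← integral_congr_ae hinner, ← integral_integral_swap (f := fun t ζ =>
    a t • (ζ - c t)⁻¹ • dbar F ζ) hI, ← integral_smul, ← integral_neg]
  refine integral_congr_ae (ae_of_all _ fun t => ?_)
  simp only [integral_smul, integral_cauchyKernel_dbar hF hs, ha]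
  module

end Fubini

/-! ### The Cauchy–Pompeiu formula on a domain -/

section Main

variable {X : Type*} [NormedAddCommGroup X] [NormedSpace ℂ X] {γ : SmoothContour} {D : Set ℂ}

theorem integrableOn_contour {j : Fin γ.n} {f : ℂ → X} (hf : ContinuousOn f γ.trace) {w : ℂ}
    (hw : w ∉ γ.trace) :
    Integrable (fun t : ℝ => deriv (γ.curve j) t • (γ.curve j t - w)⁻¹ • f (γ.curve j t))
      (volume.restrict (Ioc 0 1)) := by
  have hmem : ∀ t, γ.curve j t ∈ γ.trace := fun t => mem_iUnion.2 ⟨j, mem_range_self t⟩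
  have hc := (γ.contDiff j 1).continuous
  have h1 : Continuous fun t => f (γ.curve j t) := hf.comp_continuous hc hmem
  have h2 : Continuous fun t => (γ.curve j t - w)⁻¹ :=
    (hc.sub continuous_const).inv₀ fun t h => hw (by
      rw [← show γ.curve j t = w from sub_eq_zero.1 h]
      exact hmem t)
  exact (((γ.contDiff j 1).continuous_deriv le_rfl).smul (h2.smul h1)).integrableOn_Ioc

/-- The Cauchy–Pompeiu formula for a function defined and compactly supported in the plane. -/
theorem cauchyPompeiu_of_hasCompactSupport [CompleteSpace X] (h : γ.IsOrientedBoundary D)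
    {F : ℂ → X} (hF : ContDiff ℝ 1 F) (hs : HasCompactSupport F) {w : ℂ} (hw : w ∈ D) :
    F w = cauchyPompeiu F D γ w := by
  classical
  have hfr : frontier D = γ.trace := h.frontier_eq
  have hwt : w ∉ γ.trace := fun hw' => by
    rw [← hfr, h.isOpen.frontier_eq] at hw'
    exact hw'.2 hw
  have hwc : ∀ j, w ∉ range (γ.curve j) := fun j hj => hwt (mem_iUnion.2 ⟨j, hj⟩)
  have hint := integrable_cauchyKernel_smul (continuous_dbar hF) (hasCompactSupport_dbar hs) w
  have hpi : (Real.pi : ℂ) ≠ 0 := by exact_mod_cast Real.pi_ne_zero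
  have hcontour : (Real.pi : ℂ) • γ.pettisIntegral (fun z => (z - w)⁻¹ • F z)
      = (2 * Real.pi * Complex.I : ℂ) •
        ((Real.pi : ℂ) • F w + ∫ z in D, (z - w)⁻¹ • dbar F z) := by
    have h1 := fun j => integral_curve_cauchyKernel (γ.contDiff j 1) hF hs (hwc j)
    have hae : ∀ᵐ ζ : ℂ, ∑ j, ((windingIntegral (γ.curve j) w - windingIntegral (γ.curve j) ζ)
        * (ζ - w)⁻¹) • dbar F ζ
        -- Since `w ∈ D`, the winding difference vanishes for `ζ ∈ D` and equals `2πi` for exterior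
        -- `ζ`.
        = (2 * Real.pi * Complex.I : ℂ) • Dᶜ.indicator (fun z => (z - w)⁻¹ • dbar F z) ζ := by
      filter_upwards [measure_eq_zero_iff_ae_notMem.1 γ.volume_trace] with ζ hζ
      rw [← Finset.sum_smul, ← Finset.sum_mul, Finset.sum_sub_distrib]
      change ((γ.winding w - γ.winding ζ) * _) • _ = _
      rw [h.winding_eq hwt, h.winding_eq hζ, if_pos hw]
      by_cases hζD : ζ ∈ D
      · simp [hζD]
      · simp [hζD, smul_smul]
    rw [SmoothContour.pettisIntegral, Finset.smul_sum]
    rw [Finset.sum_congr rfl fun j _ => by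
      rw [pettisIntegral_eq_integral (integrableOn_contour hF.continuous.continuousOn hwt),
        (h1 j).2]]
    rw [Finset.sum_neg_distrib, ← integral_finsetSum _ fun j _ => (h1 j).1,
      integral_congr_ae hae, integral_smul, integral_indicator h.isOpen.measurableSet.compl,
      setIntegral_compl h.isOpen.measurableSet hint, integral_cauchyKernel_dbar hF hs]
    module
  rw [cauchyPompeiu, pettisIntegral_eq_integral hint.integrableOn]
  have h2 : γ.pettisIntegral (fun z => (z - w)⁻¹ • F z) = (2 * Complex.I : ℂ) •
        ((Real.pi : ℂ) • F w + ∫ z in D, (z - w)⁻¹ • dbar F z) := by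
    rw [← smul_right_injective X hpi |>.eq_iff]
    rw [hcontour, smul_smul]
    congr 1; ring
  rw [h2]
  have hI := Complex.I_ne_zero
  match_scalars <;> field_simp
  ring

/-- Multiply by a cutoff that is `1` near `K` and supported in `Ω`. Agreement on neighbourhoods, not
merely on `K`, is what transfers `∂̄`. -/
theorem exists_hasCompactSupport_eventuallyEq {Ω K : Set ℂ} (hΩ : IsOpen Ω) (hK : IsCompact K)
    (hKΩ : K ⊆ Ω) {f : ℂ → X} (hf : ContDiffOn ℝ 1 f Ω) :
    ∃ F : ℂ → X, ContDiff ℝ 1 F ∧ HasCompactSupport F ∧ ∀ z ∈ K, F =ᶠ[𝓝 z] f := by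
  obtain ⟨L, hL, hKL, hLΩ⟩ := exists_compact_between hK hΩ hKΩ
  obtain ⟨χ, h1, h0, -⟩ := exists_contMDiffMap_one_nhds_of_subset_interior
    (modelWithCornersSelf ℝ ℂ) (n := 1) hK.isClosed hKL
  have hχ : ContDiff ℝ 1 χ := χ.contMDiff.contDiff
  refine ⟨fun z => χ z • f z, contDiff_iff_contDiffAt.2 fun z => ?_,
    HasCompactSupport.intro hL fun z hz => by simp [h0 z hz], fun z hz => ?_⟩
  · by_cases hz : z ∈ Ω
    · exact hχ.contDiffAt.smul (hf.contDiffAt (hΩ.mem_nhds hz))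
    · refine (contDiffAt_const (c := (0 : X))).congr_of_eventuallyEq ?_
      filter_upwards [hL.isClosed.isOpen_compl.mem_nhds fun h => hz (hLΩ h)] with y hy
      simp [h0 y hy]
  · filter_upwards [eventually_nhdsSet_iff_forall.1 h1 z hz] with y hy
    simp [hy]

/-- The vector Cauchy–Pompeiu formula for a function of class `C¹` near the closure of `D`. -/
theorem cauchyPompeiu_formula {X : Type*} [NormedAddCommGroup X] [NormedSpace ℂ X] [CompleteSpace X]
    {Ω : Set ℂ} (hΩ : IsOpen Ω) {f : ℂ → X} (hf : ContDiffOn ℝ 1 f Ω) {D : Set ℂ}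
    {γ : SmoothContour} (h : γ.IsOrientedBoundary D) (hD : D ⊆ Ω) (hfr : frontier D ⊆ Ω)
    {w : ℂ} (hw : w ∈ D) :
    γ.PettisIntegrable (fun z => (z - w)⁻¹ • f z) ∧
      VectorCauchyPompeiu.PettisIntegrable
        (fun z => (z - w)⁻¹ • dbar f z) (volume.restrict D) ∧
      f w = cauchyPompeiu f D γ w := by
  have hcl : closure D ⊆ Ω := by
    rw [closure_eq_self_union_frontier]
    exact union_subset hD hfr
  obtain ⟨F, hF, hs, hFf⟩ := exists_hasCompactSupport_eventuallyEq hΩ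
    h.isBounded.isCompact_closure hcl hf
  have htr : γ.trace ⊆ closure D := by
    rw [show γ.trace = frontier D from h.frontier_eq.symm]
    exact frontier_subset_closure
  have hwt : w ∉ γ.trace := fun hw' => by
    rw [show γ.trace = frontier D from h.frontier_eq.symm, h.isOpen.frontier_eq] at hw'
    exact hw'.2 hw
  have hdbar : ∀ z ∈ D, dbar F z = dbar f z := fun z hz => by
    rw [dbar, dbar, (hFf z (subset_closure hz)).fderiv_eq]
  have hcurve : ∀ j, (fun t : ℝ => deriv (γ.curve j) t • (γ.curve j t - w)⁻¹ • f (γ.curve j t))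
      = fun t : ℝ => deriv (γ.curve j) t • (γ.curve j t - w)⁻¹ • F (γ.curve j t) := fun j => by
    funext t
    rw [(hFf _ (htr (mem_iUnion.2 ⟨j, mem_range_self t⟩))).self_of_nhds]
  have hint : Integrable (fun z => (z - w)⁻¹ • dbar F z) (volume.restrict D) :=
    (integrable_cauchyKernel_smul (continuous_dbar hF) (hasCompactSupport_dbar hs) w).integrableOn
  have hint' : Integrable (fun z => (z - w)⁻¹ • dbar f z) (volume.restrict D) :=
    IntegrableOn.congr_fun hint (fun z hz => by simp only [hdbar z hz]) h.isOpen.measurableSet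
  refine ⟨fun j => ?_, pettisIntegrable_of_integrable hint', ?_⟩
  · simp only [hcurve j]
    exact pettisIntegrable_of_integrable (integrableOn_contour hF.continuous.continuousOn hwt)
  · rw [← (hFf w (subset_closure hw)).self_of_nhds, cauchyPompeiu_of_hasCompactSupport h hF hs hw,
      cauchyPompeiu, cauchyPompeiu, pettisIntegral_eq_integral hint,
      pettisIntegral_eq_integral hint', SmoothContour.pettisIntegral, SmoothContour.pettisIntegral]
    have hset : ∫ z in D, (z - w)⁻¹ • dbar F z = ∫ z in D, (z - w)⁻¹ • dbar f z :=
      setIntegral_congr_fun h.isOpen.measurableSet fun z hz => by simp only [hdbar z hz]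
    simp only [hcurve, hset]

end Main

end

end VectorCauchyPompeiu

theorem mainTheorem6 {X : Type*} [NormedAddCommGroup X] [NormedSpace ℂ X] [CompleteSpace X]
    (Ω : Set ℂ) (hΩ : IsOpen Ω) (f : ℂ → X) (hf : ContDiffOn ℝ ∞ f Ω) :
    (∀ (D : Set ℂ) (γ : VectorCauchyPompeiu.SmoothContour), γ.IsOrientedBoundary D →
      D ⊆ Ω → frontier D ⊆ Ω → ∀ w ∈ D,
        γ.PettisIntegrable (fun z => (z - w)⁻¹ • f z) ∧
        VectorCauchyPompeiu.PettisIntegrable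
          (fun z => (z - w)⁻¹ • VectorCauchyPompeiu.dbar f z) (volume.restrict D) ∧
        f w = VectorCauchyPompeiu.cauchyPompeiu f D γ w) ∧
    (∀ (D₁ D₂ : Set ℂ) (γ₁ γ₂ : VectorCauchyPompeiu.SmoothContour),
      γ₁.IsOrientedBoundary D₁ → γ₂.IsOrientedBoundary D₂ →
      D₁ ⊆ Ω → frontier D₁ ⊆ Ω → D₂ ⊆ Ω → frontier D₂ ⊆ Ω →
      ∀ w ∈ D₁ ∩ D₂,
        VectorCauchyPompeiu.cauchyPompeiu f D₁ γ₁ w =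
          VectorCauchyPompeiu.cauchyPompeiu f D₂ γ₂ w) := by
  have hf1 : ContDiffOn ℝ 1 f Ω := hf.of_le (by exact_mod_cast le_top)
  refine ⟨fun D γ h hD hfr w hw => VectorCauchyPompeiu.cauchyPompeiu_formula hΩ hf1 h hD hfr hw,
    fun D₁ D₂ γ₁ γ₂ h₁ h₂ hD₁ hfr₁ hD₂ hfr₂ w hw => ?_⟩
  rw [← (VectorCauchyPompeiu.cauchyPompeiu_formula hΩ hf1 h₁ hD₁ hfr₁ hw.1).2.2,
    ← (VectorCauchyPompeiu.cauchyPompeiu_formula hΩ hf1 h₂ hD₂ hfr₂ hw.2).2.2]
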